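/- Let $\mathbf F_q$ be a finite field, $E$ an elliptic curve over $\mathbf F_q$ given by a Weierstrass equation, with point at infinity $O$, the identity of the group $E(\mathbf F_q)$. For a divisor $D$ of $E$ let $L(D)$ be the $\mathbf F_q$-space consisting of $0$ and the rational functions $f$ on $E$ (defined over $\mathbf F_q$) with $\operatorname{ord}_v(f)\ge -D(v)$ at every place $v$. Let $1\le k\le n$ be integers, let $Q\in E(\mathbf F_q)$, and let $P_1,\dots,P_n\in E(\mathbf F_q)\setminus\{O,Q\}$ be pairwise distinct. Let $f'\in L(Q+(k-1)O)\setminus L((k-1)O)$. Consider the code $$C=\{(f(P_1),\dots,f(P_n)) : f\in L((k-1)O)\}\subseteq \mathbf F_q^{\,n}$$ and the received word $R=(f'(P_1),\dots,f'(P_n))$. Then 1. the Hamming distance from $R$ to $C$, that is $\min_{c\in C} d(R,c)$, is either $n-k+1$ or $n-k$; 2. the distance from $R$ to $C$ equals $n-k$ if and only if there is a set $S\subseteq\{1,\dots,n\}$ of exactly $k$ indices with $\sum_{i\in S}P_i=Q$ in $E(\mathbf F_q)$. -/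

import Mathlib

open Polynomial
open scoped WithZero

namespace EllipticCode

section Curve

variable {F : Type*} [Field F] (E : WeierstrassCurve F)

abbrev CoordRing : Type _ := E.toAffine.CoordinateRing
abbrev FunField : Type _ := E.toAffine.FunctionField

theorem exists_repr (z : CoordRing E) : ∃ p q : F[X],
    z = algebraMap F[X] (CoordRing E) p +
      algebraMap F[X] (CoordRing E) q * AdjoinRoot.root E.toAffine.polynomial := by
  obtain ⟨p, q, h⟩ := WeierstrassCurve.Affine.CoordinateRing.exists_smul_basis_eq z
  refine ⟨p, q, ?_⟩
  rw [← h, Algebra.smul_def, Algebra.smul_def, mul_one]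
  rfl

theorem eval₂_equation {S : Type*} [CommRing S] (f : F[X] →+* S) (y : S) :
    eval₂ f y E.toAffine.polynomial = y ^ 2 + f (C E.a₁ * X + C E.a₃) * y -
      f (X ^ 3 + C E.a₂ * X ^ 2 + C E.a₄ * X + C E.a₆) := by
  rw [WeierstrassCurve.Affine.polynomial]
  simp only [eval₂_add, eval₂_sub, eval₂_mul, eval₂_pow, eval₂_X, eval₂_C]

theorem root_relation :
    (AdjoinRoot.root E.toAffine.polynomial : CoordRing E) ^ 2 +
      algebraMap F[X] (CoordRing E) (C E.a₁ * X + C E.a₃) *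
        AdjoinRoot.root E.toAffine.polynomial =
      algebraMap F[X] (CoordRing E) (X ^ 3 + C E.a₂ * X ^ 2 + C E.a₄ * X + C E.a₆) := by
  have h := AdjoinRoot.eval₂_root E.toAffine.polynomial
  rw [eval₂_equation] at h
  exact sub_eq_zero.mp h

/-- The involution `y ↦ -y - a₁ x - a₃` of the coordinate ring. -/
theorem exists_conj : ∃ σ : CoordRing E →ₐ[F[X]] CoordRing E,
    Function.Injective σ ∧
    σ (AdjoinRoot.root E.toAffine.polynomial) = - AdjoinRoot.root E.toAffine.polynomial -
      algebraMap F[X] (CoordRing E) (C E.a₁ * X + C E.a₃) := by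
  have hr := root_relation E
  let σ : CoordRing E →ₐ[F[X]] CoordRing E :=
    AdjoinRoot.liftAlgHom E.toAffine.polynomial (Algebra.ofId _ _)
      (- AdjoinRoot.root E.toAffine.polynomial -
      algebraMap F[X] (CoordRing E) (C E.a₁ * X + C E.a₃)) (by
        rw [eval₂_equation]
        change _ ^ 2 + algebraMap F[X] (CoordRing E) (C E.a₁ * X + C E.a₃) * _ -
          algebraMap F[X] (CoordRing E) (X ^ 3 + C E.a₂ * X ^ 2 + C E.a₄ * X + C E.a₆) = 0
        rw [← hr]; ring)
  have hσ : σ (AdjoinRoot.root E.toAffine.polynomial) =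
      - AdjoinRoot.root E.toAffine.polynomial -
      algebraMap F[X] (CoordRing E) (C E.a₁ * X + C E.a₃) := AdjoinRoot.liftAlgHom_root ..
  refine ⟨σ, ?_, hσ⟩
  have hinv : ∀ z, σ (σ z) = z := by
    intro z
    obtain ⟨p, q, rfl⟩ := exists_repr E z
    simp only [map_add, map_mul, AlgHom.commutes, hσ, map_sub, map_neg]
    ring
  exact Function.LeftInverse.injective hinv

theorem integral_quot_poly {K : Type*} [Field K] [Algebra F[X] K] [FaithfulSMul F[X] K]
    {a d : F[X]} (hd : d ≠ 0)
    (h : IsIntegral F[X] (algebraMap F[X] K a / algebraMap F[X] K d)) : d ∣ a := by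
  have hinj : Function.Injective (algebraMap F[X] K) := FaithfulSMul.algebraMap_injective _ _
  let g : FractionRing F[X] →ₐ[F[X]] K := IsFractionRing.liftAlgHom (g := Algebra.ofId F[X] K) hinj
  have hg : g (algebraMap F[X] (FractionRing F[X]) a / algebraMap F[X] (FractionRing F[X]) d) =
      algebraMap F[X] K a / algebraMap F[X] K d := by
    rw [map_div₀, AlgHom.commutes, AlgHom.commutes]
  rw [← hg, isIntegral_algHom_iff g g.toRingHom.injective] at h
  obtain ⟨c, hc⟩ := IsIntegrallyClosed.isIntegral_iff.mp h
  have hd' : algebraMap F[X] (FractionRing F[X]) d ≠ 0 := by simpa using hd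
  rw [eq_div_iff hd', ← map_mul] at hc
  exact ⟨c, by rw [← IsFractionRing.injective F[X] (FractionRing F[X]) hc, mul_comm]⟩

/-- Smoothness in the form needed for normality. -/
theorem not_singular [E.IsElliptic] {π r : F[X]} (hπ : Irreducible π)
    (hN : π ^ 2 ∣ r ^ 2 + (C E.a₁ * X + C E.a₃) * r -
      (X ^ 3 + C E.a₂ * X ^ 2 + C E.a₄ * X + C E.a₆))
    (hT : π ∣ 2 * r + (C E.a₁ * X + C E.a₃)) : False := by
  let I : Ideal F[X] := Ideal.span {π}
  let φ : F[X] →+* F[X] ⧸ I := Ideal.Quotient.mk I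
  have hI : I ≠ ⊤ := by
    rw [Ne, Ideal.span_singleton_eq_top]; exact hπ.not_isUnit
  have : Nontrivial (F[X] ⧸ I) := Ideal.Quotient.nontrivial_iff.mpr hI
  have hφ : ∀ {f : F[X]}, π ∣ f → φ f = 0 := fun h =>
    Ideal.Quotient.eq_zero_iff_mem.mpr (Ideal.mem_span_singleton.mpr h)
  let W := E.map (φ.comp C)
  have e1 : W.toAffine.Equation (φ X) (φ r) := by
    rw [WeierstrassCurve.Affine.equation_iff']
    have := hφ ((dvd_pow_self π two_ne_zero).trans hN)
    simp only [map_sub, map_add, map_mul, map_pow] at this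
    simp only [W, WeierstrassCurve.map_a₁, WeierstrassCurve.map_a₂, WeierstrassCurve.map_a₃,
      WeierstrassCurve.map_a₄, WeierstrassCurve.map_a₆, RingHom.comp_apply]
    linear_combination this
  have e2 := WeierstrassCurve.Affine.equation_iff_nonsingular.mp e1
  rw [WeierstrassCurve.Affine.nonsingular_iff'] at e2
  have hT' : 2 * φ r + (φ (C E.a₁) * φ X + φ (C E.a₃)) = 0 := by
    simpa only [map_add, map_mul, map_ofNat] using hφ hT
  have hd : π ∣ derivative (r ^ 2 + (C E.a₁ * X + C E.a₃) * r -
      (X ^ 3 + C E.a₂ * X ^ 2 + C E.a₄ * X + C E.a₆)) := by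
    obtain ⟨c, hc⟩ := hN
    rw [hc, derivative_mul, derivative_sq]
    exact dvd_add ⟨C 2 * derivative π * c, by ring⟩
      ⟨π * derivative c, by ring⟩
  have hd' := hφ hd
  simp only [derivative_add, derivative_sub, derivative_mul, derivative_pow, derivative_X,
    derivative_C, map_add, map_sub, map_mul, map_pow, map_natCast, map_one, map_zero] at hd'
  simp only [W, WeierstrassCurve.map_a₁, WeierstrassCurve.map_a₂, WeierstrassCurve.map_a₃,
      WeierstrassCurve.map_a₄, WeierstrassCurve.map_a₆, RingHom.comp_apply] at e2
  rcases e2.2 with h | h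
  · apply h
    simp at hd'
    linear_combination hd' - φ (derivative r) * hT'
  · apply h
    linear_combination hT'

theorem dvd_of_integral [E.IsElliptic] {π : F[X]} (hπ : Irreducible π) (β : CoordRing E)
    (h : IsIntegral F[X] (algebraMap (CoordRing E) (FunField E) β /
      algebraMap F[X] (FunField E) π)) : algebraMap F[X] (CoordRing E) π ∣ β := by
  obtain ⟨p, q, rfl⟩ := exists_repr E β
  set y := (AdjoinRoot.root E.toAffine.polynomial : CoordRing E) with hy
  have hinj : Function.Injective (algebraMap F[X] (FunField E)) :=
    FaithfulSMul.algebraMap_injective _ _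
  have hπ0 : algebraMap F[X] (FunField E) π ≠ 0 := by
    rw [Ne, map_eq_zero_iff _ hinj]; exact hπ.ne_zero
  have hA : ∀ a : F[X], algebraMap (CoordRing E) (FunField E) (algebraMap F[X] (CoordRing E) a) =
      algebraMap F[X] (FunField E) a := fun a =>
    (IsScalarTower.algebraMap_apply F[X] (CoordRing E) (FunField E) a).symm
  have hyint : IsIntegral F[X] (algebraMap (CoordRing E) (FunField E) y) := by
    have : IsIntegral F[X] y :=
      ⟨E.toAffine.polynomial, WeierstrassCurve.Affine.monic_polynomial, AdjoinRoot.eval₂_root _⟩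
    exact this.algebraMap
  by_cases hq : π ∣ q
  · obtain ⟨q', rfl⟩ := hq
    have h1 : IsIntegral F[X] (algebraMap F[X] (FunField E) p / algebraMap F[X] (FunField E) π) := by
      have h2 := h.sub ((isIntegral_algebraMap (x := q')).mul hyint)
      refine cast (congrArg (IsIntegral F[X]) ?_) h2
      rw [map_add, map_mul, map_mul, map_mul, hA, hA, hA]
      field_simp
      ring
    exact dvd_add (_root_.map_dvd _ (integral_quot_poly hπ.ne_zero h1))
      ((_root_.map_dvd _ (dvd_mul_right _ _)).mul_right _)
  · exfalso
    obtain ⟨u, w, huw⟩ := ((hπ.coprime_iff_not_dvd).mpr hq)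
    -- `u * π + w * q = 1`
    have h1 : IsIntegral F[X] (algebraMap (CoordRing E) (FunField E)
        (algebraMap F[X] (CoordRing E) (w * p) + y) / algebraMap F[X] (FunField E) π) := by
      have h2 := ((isIntegral_algebraMap (x := w)).mul h).add
        ((isIntegral_algebraMap (x := u)).mul hyint)
      refine cast (congrArg (IsIntegral F[X]) ?_) h2
      have h3 := congrArg (algebraMap F[X] (FunField E)) huw
      rw [map_add, map_mul, map_mul, map_one] at h3
      rw [map_add, map_add, map_mul, map_mul, map_mul, hA, hA, hA]
      field_simp
      linear_combination (algebraMap (CoordRing E) (FunField E) y) * h3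
    obtain ⟨σ, hσi, hσ⟩ := exists_conj E
    let g := (IsScalarTower.toAlgHom F[X] (CoordRing E) (FunField E)).comp σ
    have hg : Function.Injective g :=
      (IsFractionRing.injective (CoordRing E) (FunField E)).comp hσi
    let τ : FunField E →ₐ[F[X]] FunField E := IsFractionRing.liftAlgHom hg
    have hτ : ∀ z : CoordRing E, τ (algebraMap (CoordRing E) (FunField E) z) =
        algebraMap (CoordRing E) (FunField E) (σ z) := fun z => by
      change IsFractionRing.liftAlgHom hg _ = _
      rw [IsFractionRing.liftAlgHom_apply]
      exact IsFractionRing.lift_algebraMap (g := g.toRingHom) hg z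
    have h2 := h1.map τ
    rw [map_div₀, hτ, AlgHom.commutes, map_add, AlgHom.commutes, hσ] at h2
    have hr := root_relation E
    rw [← hy] at hr
    set s := w * p
    have hT : π ∣ 2 * s - (C E.a₁ * X + C E.a₃) := by
      apply integral_quot_poly (K := FunField E) hπ.ne_zero
      refine cast (congrArg (IsIntegral F[X]) ?_) (h1.add h2)
      symm
      rw [← add_div, ← map_add,
        IsScalarTower.algebraMap_apply F[X] (CoordRing E) (FunField E)
          (2 * s - (C E.a₁ * X + C E.a₃))]
      congr 2
      rw [map_sub, map_mul, map_ofNat]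
      ring
    have hN : π ^ 2 ∣ s ^ 2 - (C E.a₁ * X + C E.a₃) * s -
      (X ^ 3 + C E.a₂ * X ^ 2 + C E.a₄ * X + C E.a₆) := by
      apply integral_quot_poly (K := FunField E) (pow_ne_zero _ hπ.ne_zero)
      refine cast (congrArg (IsIntegral F[X]) ?_) (h1.mul h2)
      symm
      rw [div_mul_div_comm, ← map_mul, map_pow, ← sq,
        IsScalarTower.algebraMap_apply F[X] (CoordRing E) (FunField E)
          (s ^ 2 - (C E.a₁ * X + C E.a₃) * s -
      (X ^ 3 + C E.a₂ * X ^ 2 + C E.a₄ * X + C E.a₆))]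
      congr 2
      rw [map_sub, ← hr, map_sub, map_mul, map_pow]
      ring
    refine not_singular E (r := -s) hπ ?_ ?_
    · convert hN using 1; ring
    · rw [← dvd_neg]; convert hT using 1; ring

instance instIsDedekindDomain [E.IsElliptic] : IsDedekindDomain (CoordRing E) := by
  have hfin : Module.Finite F[X] (CoordRing E) :=
    Module.Finite.of_basis (WeierstrassCurve.Affine.CoordinateRing.basis E.toAffine)
  have : IsNoetherianRing (CoordRing E) := IsNoetherianRing.of_finite F[X] _
  have : Algebra.IsIntegral F[X] (CoordRing E) := Algebra.IsIntegral.of_finite _ _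
  have : Ring.DimensionLEOne (CoordRing E) := Ring.DimensionLEOne.of_isIntegral F[X] _
  have : IsIntegrallyClosed (CoordRing E) := by
    rw [isIntegrallyClosed_iff (FunField E)]
    intro z hz
    have hz' : IsIntegral F[X] z := isIntegral_trans z hz
    have hinj : Function.Injective (algebraMap F[X] (FunField E)) :=
      FaithfulSMul.algebraMap_injective _ _
    have hA : ∀ a : F[X], algebraMap (CoordRing E) (FunField E)
        (algebraMap F[X] (CoordRing E) a) = algebraMap F[X] (FunField E) a := fun a =>
      (IsScalarTower.algebraMap_apply F[X] (CoordRing E) (FunField E) a).symm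
    obtain ⟨⟨α, s⟩, hs⟩ := IsLocalization.surj (nonZeroDivisors (CoordRing E)) z
    obtain ⟨d, hd0, t, hd⟩ : ∃ d : F[X], d ≠ 0 ∧ (s : CoordRing E) ∣ algebraMap F[X] _ d := by
      have hs0 : (s : CoordRing E) ≠ 0 := nonZeroDivisors.ne_zero s.2
      obtain ⟨d, hd, hd0⟩ := Submodule.exists_mem_ne_zero_of_ne_bot
        (Ideal.comap_ne_bot_of_integral_mem (R := F[X]) hs0 (Ideal.mem_span_singleton_self _)
          (Algebra.IsIntegral.isIntegral _))
      exact ⟨d, hd0, Ideal.mem_span_singleton.mp hd⟩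
    have key : ∀ d : F[X], d ≠ 0 → ∀ (z : FunField E) (α : CoordRing E), IsIntegral F[X] z →
        z * algebraMap F[X] (FunField E) d = algebraMap _ _ α →
        ∃ y, algebraMap (CoordRing E) (FunField E) y = z := by
      intro d
      induction d using WfDvdMonoid.induction_on_irreducible with
      | zero => intro h; exact absurd rfl h
      | unit u hu =>
        intro _ z α _ h
        obtain ⟨v, hv⟩ := hu.exists_right_inv
        refine ⟨α * algebraMap F[X] _ v, ?_⟩
        rw [map_mul, ← h, hA, mul_assoc, ← map_mul, hv, map_one, mul_one]
      | mul d π hd hπ ih =>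
        intro _ z α hz h
        have hπ0 : algebraMap F[X] (FunField E) π ≠ 0 := by
          rw [Ne, map_eq_zero_iff _ hinj]; exact hπ.ne_zero
        have h1 : z * algebraMap F[X] (FunField E) d =
            algebraMap _ _ α / algebraMap F[X] (FunField E) π := by
          rw [eq_div_iff hπ0, ← h, map_mul]; ring
        have h2 := dvd_of_integral E hπ α (h1 ▸ hz.mul isIntegral_algebraMap)
        obtain ⟨β, rfl⟩ := h2
        refine ih hd z β hz ?_
        rw [h1, map_mul, hA, mul_div_cancel_left₀ _ hπ0]
    refine key d hd0 z (α * t) hz' ?_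
    rw [← hA, hd, map_mul, ← mul_assoc, hs, map_mul]
  exact {}

/-! ### The place at infinity -/

theorem degree_norm_repr (p q : F[X]) :
    (Algebra.norm F[X] (algebraMap F[X] (CoordRing E) p +
      algebraMap F[X] (CoordRing E) q * AdjoinRoot.root E.toAffine.polynomial)).degree =
      max (2 • p.degree) (2 • q.degree + 3) := by
  rw [← WeierstrassCurve.Affine.CoordinateRing.degree_norm_smul_basis (W' := E.toAffine) p q,
    Algebra.smul_def, Algebra.smul_def, mul_one]
  rfl

theorem degree_norm_add_le (a b : CoordRing E) :
    (Algebra.norm F[X] (a + b)).degree ≤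
      max (Algebra.norm F[X] a).degree (Algebra.norm F[X] b).degree := by
  obtain ⟨p, q, rfl⟩ := exists_repr E a
  obtain ⟨r, s, rfl⟩ := exists_repr E b
  have h : ∀ (y : CoordRing E), algebraMap F[X] (CoordRing E) p + algebraMap F[X] (CoordRing E) q * y +
      (algebraMap F[X] (CoordRing E) r + algebraMap F[X] (CoordRing E) s * y) =
      algebraMap F[X] (CoordRing E) (p + r) + algebraMap F[X] (CoordRing E) (q + s) * y := by
    intro y; rw [map_add, map_add]; ring
  rw [h, degree_norm_repr, degree_norm_repr, degree_norm_repr]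
  refine max_le ?_ ?_
  · rcases le_max_iff.mp (degree_add_le p r) with h | h
    · exact (nsmul_le_nsmul_right h 2).trans ((le_max_left _ _).trans (le_max_left _ _))
    · exact (nsmul_le_nsmul_right h 2).trans ((le_max_left _ _).trans (le_max_right _ _))
  · rcases le_max_iff.mp (degree_add_le q s) with h | h
    · exact (add_le_add_left (nsmul_le_nsmul_right h 2) 3).trans
        ((le_max_right _ _).trans (le_max_left _ _))
    · exact (add_le_add_left (nsmul_le_nsmul_right h 2) 3).trans
        ((le_max_right _ _).trans (le_max_right _ _))

theorem norm_ne_zero {a : CoordRing E} (ha : a ≠ 0) : Algebra.norm F[X] a ≠ 0 := by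
  have : Module.Finite F[X] (CoordRing E) :=
    Module.Finite.of_basis (WeierstrassCurve.Affine.CoordinateRing.basis E.toAffine)
  exact Algebra.norm_ne_zero_iff.mpr ha

open Classical in
/-- The valuation of the coordinate ring `F[x, y]` at the point at infinity `O`. The exponent is
the pole order at `O`: for `a = p(x) + q(x) y` it is `max (2 * deg p) (2 * deg q + 3)`, the degree
in `x` of the norm of `a`. So `x` has a pole of order `2` and `y` has a pole of order `3`. -/
noncomputable def infinityValuationAux : Valuation (CoordRing E) ℤᵐ⁰ where
  toFun a := if a = 0 then 0 else WithZero.exp ((Algebra.norm F[X] a).natDegree : ℤ)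
  map_zero' := if_pos rfl
  map_one' := by simp
  map_mul' a b := by
    by_cases ha : a = 0
    · simp [ha]
    by_cases hb : b = 0
    · simp [hb]
    rw [if_neg ha, if_neg hb, if_neg (mul_ne_zero ha hb), map_mul,
      natDegree_mul (norm_ne_zero E ha) (norm_ne_zero E hb), Nat.cast_add, WithZero.exp_add]
  map_add_le_max' a b := by
    by_cases ha : a = 0
    · simp [ha]
    by_cases hb : b = 0
    · simp [hb]
    by_cases hab : a + b = 0
    · simp [hab]
    rw [if_neg ha, if_neg hb, if_neg hab]
    have h := degree_norm_add_le E a b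
    rw [degree_eq_natDegree (norm_ne_zero E ha), degree_eq_natDegree (norm_ne_zero E hb),
      degree_eq_natDegree (norm_ne_zero E hab)] at h
    rcases le_max_iff.mp h with h | h
    · exact le_max_of_le_left (WithZero.exp_le_exp.mpr (by exact_mod_cast h))
    · exact le_max_of_le_right (WithZero.exp_le_exp.mpr (by exact_mod_cast h))

theorem nonZeroDivisors_le_supp :
    nonZeroDivisors (CoordRing E) ≤ (infinityValuationAux E).supp.primeCompl := by
  intro a ha h
  have ha0 : a ≠ 0 := nonZeroDivisors.ne_zero ha
  have h' : infinityValuationAux E a = 0 := h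
  have h'' : infinityValuationAux E a = WithZero.exp ((Algebra.norm F[X] a).natDegree : ℤ) :=
    if_neg ha0
  rw [h''] at h'
  exact WithZero.exp_ne_zero h'

/-- The valuation of the function field at the point at infinity `O`. -/
noncomputable def infinityValuation : Valuation (FunField E) ℤᵐ⁰ :=
  (infinityValuationAux E).extendToLocalization (nonZeroDivisors_le_supp E) (FunField E)

/-! ### Places, divisors, Riemann-Roch spaces -/

/-- A place of the function field of `E` over `F`: the place at the point at infinity `O` (written
`none`), or a closed point of the affine curve, i.e. a nonzero prime ideal of the coordinate ring. -/
abbrev Place : Type _ := Option (IsDedekindDomain.HeightOneSpectrum (CoordRing E))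

theorem XYIdeal_isPrime {x y : F} (h : E.toAffine.Nonsingular x y) :
    (WeierstrassCurve.Affine.CoordinateRing.XYIdeal E.toAffine x (C y)).IsPrime := by
  have e := WeierstrassCurve.Affine.CoordinateRing.quotientXYIdealEquiv (W' := E.toAffine)
    (x := x) (y := C y) h.1
  have : IsDomain (CoordRing E ⧸
      WeierstrassCurve.Affine.CoordinateRing.XYIdeal E.toAffine x (C y)) :=
    e.toRingEquiv.toMulEquiv.isDomain F
  exact (Ideal.Quotient.isDomain_iff_prime _).mp this

theorem XYIdeal_ne_bot (x y : F) :
    WeierstrassCurve.Affine.CoordinateRing.XYIdeal E.toAffine x (C y) ≠ ⊥ := by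
  intro h
  have hx : WeierstrassCurve.Affine.CoordinateRing.XClass E.toAffine x ∈
      WeierstrassCurve.Affine.CoordinateRing.XYIdeal E.toAffine x (C y) :=
    Ideal.subset_span (Set.mem_insert _ _)
  rw [h] at hx
  exact WeierstrassCurve.Affine.CoordinateRing.XClass_ne_zero (W' := E.toAffine) x hx

variable [E.IsElliptic]

/-- The normalised valuation `|f|_v = exp (-ord_v f)` at a place. -/
noncomputable def placeValuation : Place E → Valuation (FunField E) ℤᵐ⁰
  | none => infinityValuation E
  | some v => v.valuation (FunField E)

theorem placeValuation_algebraMap_le_one (v : Place E) (c : F) :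
    placeValuation E v (algebraMap F (FunField E) c) ≤ 1 := by
  rw [IsScalarTower.algebraMap_apply F (CoordRing E) (FunField E)]
  cases v with
  | none =>
    change infinityValuation E _ ≤ 1
    rw [infinityValuation, Valuation.extendToLocalization_apply_map_apply]
    by_cases hc : algebraMap F (CoordRing E) c = 0
    · rw [hc, map_zero]; exact zero_le_one
    · have h : infinityValuationAux E (algebraMap F (CoordRing E) c) = WithZero.exp
          ((Algebra.norm F[X] (algebraMap F (CoordRing E) c)).natDegree : ℤ) := if_neg hc
      rw [h, IsScalarTower.algebraMap_apply F F[X] (CoordRing E),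
        Algebra.norm_algebraMap_of_basis
          (WeierstrassCurve.Affine.CoordinateRing.basis E.toAffine)]
      simp
  | some v => exact v.valuation_le_one _

/-- A divisor of the function field. -/
abbrev Divisor : Type _ := Place E →₀ ℤ

/-- `L(D)`: the functions `f` with `ord_v f ≥ -D(v)` at every place `v`, together with `0`. -/
noncomputable def riemannRochSpace (D : Divisor E) : Submodule F (FunField E) where
  carrier := {f | ∀ v : Place E, placeValuation E v f ≤ WithZero.exp (D v)}
  zero_mem' v := by simp
  add_mem' hf hg v := ((placeValuation E v).map_add _ _).trans (max_le (hf v) (hg v))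
  smul_mem' c f hf v := by
    rw [Algebra.smul_def, map_mul]
    exact (mul_le_mul' (placeValuation_algebraMap_le_one E v c) (hf v)).trans_eq (one_mul _)

/-! ### Rational points and evaluation -/

/-- The place of a rational point: `O` gives the place at infinity, an affine point `(a, b)` gives
the maximal ideal `⟨x - a, y - b⟩` of the coordinate ring. -/
noncomputable def pointPlace : E.toAffine.Point → Place E
  | .zero => none
  | .some x y h => some
      ⟨WeierstrassCurve.Affine.CoordinateRing.XYIdeal E.toAffine x (C y),
        XYIdeal_isPrime E h, XYIdeal_ne_bot E x y⟩

open Classical in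
/-- The value `f(P)` of a function regular at the rational point `P`: the constant `c` such that
`f - c` vanishes at `P`, i.e. the residue of `f` at `P`. (The value is `0` if `f` has a pole.) -/
noncomputable def evalAt (f : FunField E) (P : E.toAffine.Point) : F :=
  if h : ∃ c : F, placeValuation E (pointPlace E P) (f - algebraMap F (FunField E) c) < 1 then
    h.choose else 0

/-- The residue is unique, so `evalAt` does not depend on a choice. -/
theorem evalAt_eq {f : FunField E} {P : E.toAffine.Point} {c : F}
    (hc : placeValuation E (pointPlace E P) (f - algebraMap F (FunField E) c) < 1) :
    evalAt E f P = c := by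
  have h : ∃ c : F, placeValuation E (pointPlace E P) (f - algebraMap F (FunField E) c) < 1 :=
    ⟨c, hc⟩
  rw [evalAt, dif_pos h]
  have h1 := h.choose_spec
  set d := h.choose
  by_contra hdc
  have h2 := Valuation.map_sub_lt _ hc h1
  rw [sub_sub_sub_cancel_left, ← map_sub] at h2
  have h3 := placeValuation_algebraMap_le_one E (pointPlace E P) (d - c)⁻¹
  have h4 := mul_lt_one_of_lt_of_le h2 h3
  rw [← map_mul, ← map_mul, mul_inv_cancel₀ (sub_ne_zero.mpr hdc), map_one, map_one] at h4
  exact lt_irrefl _ h4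

/-- The algebraic geometry code obtained by evaluating the functions of `L(D)` at `P₁, …, Pₙ`. -/
def agCode {n : ℕ} (D : Divisor E) (P : Fin n → E.toAffine.Point) : Set (Fin n → F) :=
  {c | ∃ f ∈ riemannRochSpace E D, c = fun i => evalAt E f (P i)}

end Curve

/-- The Hamming distance from a word to a (nonempty) code. -/
noncomputable def distToCode {F : Type*} [DecidableEq F] {n : ℕ}
    (R : Fin n → F) (C : Set (Fin n → F)) : ℕ :=
  sInf {d | ∃ c ∈ C, d = hammingDist R c}

end EllipticCode

/-! A nonzero `h` in `L(Q + (k-1)O)` has at most `k` zeros, and if it vanishes at `k` distinct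
points `P i` away from `Q` and `O`, its divisor is their sum minus `Q + (k-1)O`, so by Abel's
theorem they add up to `Q` (`card_zeros_le`). Applied to `f' - f`, which is nonzero because `f'` is
not in `L((k-1)O)`, this bounds the agreement of the word with any codeword by `k` and describes the
case of equality.

Conversely, take `k - 1` of the `P i` and a point `B ≠ Q` which together sum to `Q`. Then some `h`
in `L(Q + (k-1)O)` vanishes at these `P i`, and at `B` if `B ≠ O`, and it lies outside `L((k-1)O)`
(`exists_function_of_sum_eq`). As `L((k-1)O)` has codimension at most one (`exists_sub_smul_mem`),
some `f' - c • h` is a codeword function, agreeing with `f'` wherever `h` vanishes. Taking for `B` a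
`k`-th point `P i` gives distance `n - k`; an arbitrary `B` gives at most `n - k + 1`.

Divisors are handled through ideals of the coordinate ring. Abel's theorem is the injectivity of
`Point.toClass` into the class group. Degrees are degrees of norms to `F[x]`: for an element this is
also its pole order at `O`, so zeros and poles balance. A pole at `Q` is cleared by the vertical
line `g` through `Q` and `-Q`, at the cost of an extra zero at `-Q`. -/

namespace EllipticCode

open WeierstrassCurve.Affine WeierstrassCurve.Affine.CoordinateRing

/-! ### Ideals of rational points and the class group. -/

section PointIdeal

variable {F : Type*} [Field F] (E : WeierstrassCurve F)

/-- The ideal of the coordinate ring of functions vanishing at a rational point; it is the whole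
ring for the point at infinity. -/
noncomputable def pointIdeal : E.toAffine.Point → Ideal (CoordRing E)
  | .zero => ⊤
  | .some x y _ => XYIdeal E.toAffine x (C y)

/-- The degree of the affine part of a rational point: `0` for the point at infinity, `1` for an
affine point. -/
def affineDegree : E.toAffine.Point → ℕ
  | .zero => 0
  | .some _ _ _ => 1

theorem affineDegree_zero : affineDegree E 0 = 0 := rfl

theorem affineDegree_of_ne_zero {P : E.toAffine.Point} (hP : P ≠ 0) : affineDegree E P = 1 := by
  cases P with
  | zero => exact absurd rfl hP
  | some x y h => rfl

theorem affineDegree_neg (P : E.toAffine.Point) : affineDegree E (-P) = affineDegree E P := by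
  cases P <;> rfl

theorem pointIdeal_ne_bot (P : E.toAffine.Point) : pointIdeal E P ≠ ⊥ := by
  cases P with
  | zero => exact top_ne_bot
  | some x y h => exact XYIdeal_ne_bot E x y

theorem pointIdeal_isMaximal {P : E.toAffine.Point} (hP : P ≠ 0) : (pointIdeal E P).IsMaximal := by
  cases P with
  | zero => exact absurd rfl hP
  | some x y h =>
    exact Ideal.Quotient.maximal_of_isField _
      ((quotientXYIdealEquiv (W' := E.toAffine) (x := x) (y := C y) h.1).toRingEquiv.toMulEquiv.isField
        (Field.toIsField F))

theorem exists_sub_mem_pointIdeal (P : E.toAffine.Point) (r : CoordRing E) :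
    ∃ c : F, r - algebraMap F (CoordRing E) c ∈ pointIdeal E P := by
  cases P with
  | zero => exact ⟨0, Submodule.mem_top⟩
  | some x y h =>
    let e := quotientXYIdealEquiv (W' := E.toAffine) (x := x) (y := C y) h.1
    refine ⟨e (Ideal.Quotient.mk _ r), ?_⟩
    change _ ∈ XYIdeal E.toAffine x (C y)
    rw [← Ideal.Quotient.eq]
    apply e.injective
    exact (e.commutes _).symm

/-- The vertical line through an affine `P` meets the affine curve in `P` and `-P`; for `O` the
constant `1` serves. This `g` later clears the pole at `Q`. -/
theorem exists_pointIdeal_neg_mul (P : E.toAffine.Point) : ∃ g : CoordRing E, g ≠ 0 ∧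
    pointIdeal E (-P) * pointIdeal E P = Ideal.span {g} := by
  cases P with
  | zero => exact ⟨1, one_ne_zero, by rw [Ideal.span_singleton_one]; exact Ideal.top_mul _⟩
  | some x y h => exact ⟨_, XClass_ne_zero x, XYIdeal_neg_mul h⟩

theorem multiset_prod_pointIdeal_ne_bot (s : Multiset E.toAffine.Point) :
    (s.map (pointIdeal E)).prod ≠ ⊥ := by
  refine Multiset.prod_ne_zero fun h => ?_
  obtain ⟨P, -, hP⟩ := Multiset.mem_map.mp h
  exact pointIdeal_ne_bot E P hP

variable [E.IsElliptic]

/-- The class of a rational point is the class of its ideal. -/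
theorem toClass_eq_mk0 [DecidableEq F] (P : E.toAffine.Point) :
    (Point.toClass P).toMul = ClassGroup.mk0 ⟨pointIdeal E P,
      mem_nonZeroDivisors_of_ne_zero (pointIdeal_ne_bot E P)⟩ := by
  cases P with
  | zero =>
    symm
    exact (ClassGroup.mk0_eq_one_iff _).mpr ⟨1, by
      rw [Ideal.submodule_span_eq, Ideal.span_singleton_one]; rfl⟩
  | some x y h =>
    rw [← ClassGroup.mk_mk0 (FunField E)]
    change ClassGroup.mk _ _ = _
    congr 1
    ext1
    rw [FractionalIdeal.coe_mk0]
    exact XYIdeal'_eq h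

theorem pointIdeal_injective [DecidableEq F] : Function.Injective (pointIdeal E) := by
  intro P Q h
  apply Point.toClass_injective
  apply Additive.toMul.injective
  rw [toClass_eq_mk0, toClass_eq_mk0]
  congr 1
  exact Subtype.ext h

theorem eq_of_pointIdeal_le [DecidableEq F] {P Q : E.toAffine.Point} (hQ : Q ≠ 0)
    (h : pointIdeal E P ≤ pointIdeal E Q) : P = Q := by
  have hQm := pointIdeal_isMaximal E hQ
  by_cases hP : P = 0
  · subst hP
    exact absurd (top_le_iff.mp h) hQm.ne_top
  · exact pointIdeal_injective E ((pointIdeal_isMaximal E hP).eq_of_le hQm.ne_top h)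

/-- A sum of rational points is trivial exactly when the product of their ideals is principal. -/
theorem multiset_sum_eq_zero_iff [DecidableEq F] (s : Multiset E.toAffine.Point) :
    s.sum = 0 ↔ (s.map (pointIdeal E)).prod.IsPrincipal := by
  have h : ∀ s : Multiset E.toAffine.Point, (Point.toClass s.sum).toMul =
      ClassGroup.mk0 ⟨(s.map (pointIdeal E)).prod,
        mem_nonZeroDivisors_of_ne_zero (multiset_prod_pointIdeal_ne_bot E s)⟩ := by
    intro s
    induction s using Multiset.induction_on with
    | empty =>
      symm
      simp only [Multiset.sum_zero, Point.toClass_zero, toMul_zero]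
      exact (ClassGroup.mk0_eq_one_iff _).mpr ⟨1, by
        rw [Ideal.submodule_span_eq, Ideal.span_singleton_one]; simp⟩
    | cons P s ih =>
      rw [Multiset.sum_cons, map_add, toMul_add, ih, toClass_eq_mk0, ← map_mul]
      congr 1
      ext1
      simp
  -- Principal means trivial class, and `Point.toClass` has trivial kernel.
  rw [← ClassGroup.mk0_eq_one_iff
    (mem_nonZeroDivisors_of_ne_zero (multiset_prod_pointIdeal_ne_bot E s)), ← h,
    ← Point.toClass_eq_zero]
  exact toMul_eq_one.symm

/-! ### Degrees of ideals through the relative norm. -/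

instance instFiniteCoordRing : Module.Finite F[X] (CoordRing E) :=
  Module.Finite.of_basis (CoordinateRing.basis E.toAffine)

instance instFreeCoordRing : Module.Free F[X] (CoordRing E) :=
  Module.Free.of_basis (CoordinateRing.basis E.toAffine)

/-- The relative norm of `J` to `F[x]` is generated by a polynomial of degree `m`, that is,
`J` has colength `m`. -/
def HasNormDegree (J : Ideal (CoordRing E)) (m : ℕ) : Prop :=
  ∃ f : F[X], f ≠ 0 ∧ f.natDegree = m ∧ Ideal.relNorm F[X] J = Ideal.span {f}

variable {E}

theorem HasNormDegree.unique {J : Ideal (CoordRing E)} {m m' : ℕ} (h : HasNormDegree E J m)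
    (h' : HasNormDegree E J m') : m = m' := by
  obtain ⟨f, -, rfl, hf⟩ := h
  obtain ⟨g, -, rfl, hg⟩ := h'
  exact natDegree_eq_of_degree_eq
    (degree_eq_degree_of_associated (Ideal.span_singleton_eq_span_singleton.mp (hf.symm.trans hg)))

theorem HasNormDegree.mul {I J : Ideal (CoordRing E)} {m m' : ℕ} (h : HasNormDegree E I m)
    (h' : HasNormDegree E J m') : HasNormDegree E (I * J) (m + m') := by
  obtain ⟨f, hf0, rfl, hf⟩ := h
  obtain ⟨g, hg0, rfl, hg⟩ := h'
  exact ⟨f * g, mul_ne_zero hf0 hg0, natDegree_mul hf0 hg0, by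
    rw [map_mul, hf, hg, Ideal.span_singleton_mul_span_singleton]⟩

theorem hasNormDegree_top : HasNormDegree E ⊤ 0 :=
  ⟨1, one_ne_zero, natDegree_one, by rw [Ideal.relNorm_top, Ideal.span_singleton_one]⟩

theorem relNorm_span_singleton (a : CoordRing E) :
    Ideal.relNorm F[X] (Ideal.span {a}) = Ideal.span {Algebra.norm F[X] a} := by
  rw [Ideal.relNorm_singleton, Algebra.intNorm_eq_norm]

theorem hasNormDegree_span {a : CoordRing E} (ha : a ≠ 0) :
    HasNormDegree E (Ideal.span {a}) (Algebra.norm F[X] a).natDegree :=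
  ⟨_, norm_ne_zero E ha, rfl, relNorm_span_singleton a⟩

theorem exists_hasNormDegree {J : Ideal (CoordRing E)} (hJ : J ≠ ⊥) :
    ∃ m, HasNormDegree E J m := by
  obtain ⟨f, hf⟩ := IsPrincipalIdealRing.principal (Ideal.relNorm F[X] J)
  refine ⟨f.natDegree, f, ?_, rfl, hf⟩
  rintro rfl
  apply hJ
  rw [← Ideal.relNorm_eq_bot_iff (R := F[X]), hf]
  exact Submodule.span_zero_singleton _

/-- The relative norm lies in `J ∩ F[x]`, and a generator of degree `0` is a unit. -/
theorem HasNormDegree.eq_top {J : Ideal (CoordRing E)} (h : HasNormDegree E J 0) : J = ⊤ := by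
  obtain ⟨f, hf0, hf, hJ⟩ := h
  have hu : IsUnit f := isUnit_iff_degree_eq_zero.mpr (by rw [degree_eq_natDegree hf0, hf]; rfl)
  have h1 := Ideal.relNorm_le_comap F[X] J
  rw [hJ, Ideal.span_singleton_eq_top.mpr hu, top_le_iff] at h1
  rw [Ideal.eq_top_iff_one]
  have : (1 : F[X]) ∈ J.comap (algebraMap F[X] (CoordRing E)) := h1 ▸ Submodule.mem_top
  simpa using this

/-- For affine `P`, the ideals of `P` and `-P` multiply to `(x - a)`, whose norm `(x - a)²` has
degree `2`. Both ideals are proper, so each has degree exactly `1`. -/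
theorem hasNormDegree_pointIdeal (P : E.toAffine.Point) :
    HasNormDegree E (pointIdeal E P) (affineDegree E P) := by
  by_cases hP : P = 0
  · subst hP; exact hasNormDegree_top
  obtain ⟨m, hm⟩ := exists_hasNormDegree (pointIdeal_ne_bot E P)
  obtain ⟨m', hm'⟩ := exists_hasNormDegree (pointIdeal_ne_bot E (-P))
  have h0 : ∀ {P : E.toAffine.Point} {m : ℕ}, P ≠ 0 → HasNormDegree E (pointIdeal E P) m →
      m ≠ 0 := by
    rintro P m hP h rfl
    exact (pointIdeal_isMaximal E hP).ne_top h.eq_top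
  have hsum : m' + m = 2 := by
    cases P with
    | zero => exact absurd rfl hP
    | some x y h =>
      have h1 := hm'.mul hm
      rw [show pointIdeal E (-(Point.some x y h)) * pointIdeal E (Point.some x y h) =
        Ideal.span {XClass E.toAffine x} from XYIdeal_neg_mul h] at h1
      refine h1.unique ?_
      convert hasNormDegree_span (XClass_ne_zero (W' := E.toAffine) x) using 1
      have : (XClass E.toAffine x : CoordRing E) = algebraMap F[X] (CoordRing E) (X - C x) := rfl
      rw [this, Algebra.norm_algebraMap_of_basis (CoordinateRing.basis E.toAffine)]
      simp
  have := h0 hP hm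
  have := h0 (by cases P with
    | zero => exact absurd rfl hP
    | some x y h => exact Point.some_ne_zero _) hm'
  rw [affineDegree_of_ne_zero E hP]
  convert hm using 1
  omega

theorem hasNormDegree_multiset_prod (s : Multiset E.toAffine.Point) :
    HasNormDegree E (s.map (pointIdeal E)).prod (s.map (affineDegree E)).sum := by
  induction s using Multiset.induction_on with
  | empty => simpa using hasNormDegree_top
  | cons P s ih => simpa using (hasNormDegree_pointIdeal P).mul ih

/-- Containment is divisibility in a Dedekind domain: `(a) = J * K` and degrees add. If `K` has
degree `0` it is the unit ideal. This replaces "number of zeros equals number of poles". -/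
theorem HasNormDegree.le_natDegree_norm {J : Ideal (CoordRing E)} {m : ℕ}
    (hJ : HasNormDegree E J m) {a : CoordRing E} (ha : a ≠ 0) (haJ : a ∈ J) :
    m ≤ (Algebra.norm F[X] a).natDegree ∧
      ((Algebra.norm F[X] a).natDegree ≤ m → J = Ideal.span {a}) := by
  obtain ⟨K, hK⟩ := Ideal.dvd_iff_le.mpr ((Ideal.span_singleton_le_iff_mem J).mpr haJ)
  have hK0 : K ≠ ⊥ := by
    rintro rfl
    rw [Ideal.mul_bot, Ideal.span_singleton_eq_bot] at hK
    exact ha hK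
  obtain ⟨m', hm'⟩ := exists_hasNormDegree hK0
  have h := (hK ▸ hasNormDegree_span ha).unique (hJ.mul hm')
  refine ⟨by omega, fun hle => ?_⟩
  obtain rfl : m' = 0 := by omega
  rw [hK, hm'.eq_top, Ideal.mul_top]

end PointIdeal

/-! ### Residues at rational points. -/

section Valuations

variable {F : Type*} [Field F] (E : WeierstrassCurve F)

theorem infinityValuation_algebraMap {a : CoordRing E} (ha : a ≠ 0) :
    infinityValuation E (algebraMap _ (FunField E) a) =
      WithZero.exp ((Algebra.norm F[X] a).natDegree : ℤ) := by
  rw [infinityValuation, Valuation.extendToLocalization_apply_map_apply]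
  exact if_neg ha

/-- Vanishing of coefficients is linear in `p` and needs no exception at `p = 0`, which suits the
cancellation of leading terms. -/
theorem nsmul_degree_add_lt_iff (p : F[X]) (j N : ℕ) :
    2 • p.degree + (j : WithBot ℕ) < (N : WithBot ℕ) ↔ ∀ i, N ≤ 2 * i + j → p.coeff i = 0 := by
  by_cases hp : p = 0
  · subst hp
    simp
  have h : 2 • p.degree + (j : WithBot ℕ) < (N : WithBot ℕ) ↔ 2 * p.natDegree + j < N := by
    rw [degree_eq_natDegree hp, two_nsmul, two_mul]
    norm_cast
  rw [h]
  constructor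
  · intro h i hi
    exact coeff_eq_zero_of_natDegree_lt (by omega)
  · intro h
    by_contra! hlt
    exact hp (leadingCoeff_eq_zero.mp (h _ hlt))

theorem degree_norm_lt_iff (p q : F[X]) (N : ℕ) :
    (Algebra.norm F[X] (algebraMap F[X] (CoordRing E) p +
      algebraMap F[X] (CoordRing E) q * AdjoinRoot.root E.toAffine.polynomial)).degree < N ↔
      (∀ i, N ≤ 2 * i → p.coeff i = 0) ∧ ∀ i, N ≤ 2 * i + 3 → q.coeff i = 0 := by
  rw [degree_norm_repr, max_lt_iff]
  refine and_congr ?_ (nsmul_degree_add_lt_iff q 3 N)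
  simpa using nsmul_degree_add_lt_iff p 0 N

/-- Two elements of the coordinate ring with the same pole order at infinity have proportional
leading terms. -/
theorem exists_degree_norm_sub_lt {a b : CoordRing E} (hb : b ≠ 0)
    (h : (Algebra.norm F[X] a).degree ≤ (Algebra.norm F[X] b).degree) :
    ∃ c : F, (Algebra.norm F[X] (a - algebraMap F (CoordRing E) c * b)).degree <
      (Algebra.norm F[X] b).degree := by
  obtain ⟨N, hN⟩ : ∃ N : ℕ, (Algebra.norm F[X] b).degree = N :=
    ⟨_, degree_eq_natDegree (norm_ne_zero E hb)⟩
  have hlt : (N : WithBot ℕ) < ((N + 1 : ℕ) : WithBot ℕ) := by exact_mod_cast N.lt_succ_self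
  rw [hN] at h ⊢
  have ha := h.trans_lt hlt
  have hb1 := hN.trans_lt hlt
  have hb2 := hN.not_lt
  obtain ⟨p, q, rfl⟩ := exists_repr E a
  obtain ⟨r, s, rfl⟩ := exists_repr E b
  have hc : ∀ c : F, algebraMap F[X] (CoordRing E) p +
      algebraMap F[X] (CoordRing E) q * AdjoinRoot.root E.toAffine.polynomial -
      algebraMap F (CoordRing E) c * (algebraMap F[X] (CoordRing E) r +
      algebraMap F[X] (CoordRing E) s * AdjoinRoot.root E.toAffine.polynomial) =
      algebraMap F[X] (CoordRing E) (p - C c * r) +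
      algebraMap F[X] (CoordRing E) (q - C c * s) * AdjoinRoot.root E.toAffine.polynomial := by
    intro c
    rw [IsScalarTower.algebraMap_apply F F[X] (CoordRing E), Polynomial.algebraMap_eq]
    simp only [map_sub, map_mul]
    ring
  simp only [hc, degree_norm_lt_iff, coeff_sub, coeff_C_mul] at ha hb1 hb2 ⊢
  obtain ⟨hp, hq⟩ := ha
  obtain ⟨hr, hs⟩ := hb1
  rw [Classical.not_and_iff_not_or_not] at hb2
  push Not at hb2
  obtain ⟨m, hm, hm0⟩ | ⟨m, hm, hm0⟩ := hb2
  -- The pole orders `2i` of `x^i` and `2i + 3` of `x^i y` differ in parity, so a single coefficient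
  -- carries the pole order `N`; the quotient of the two coefficients cancels it.
  · have hmN : N = 2 * m := hm.antisymm (by by_contra! h; exact hm0 (hr m h))
    refine ⟨p.coeff m / r.coeff m, fun i hi => ?_, fun i hi => ?_⟩
    · obtain rfl | him := eq_or_ne i m
      · rw [div_mul_cancel₀ _ hm0, sub_self]
      · rw [hp i (by omega), hr i (by omega), mul_zero, sub_zero]
    · rw [hq i (by omega), hs i (by omega), mul_zero, sub_zero]
  · have hmN : N = 2 * m + 3 := hm.antisymm (by by_contra! h; exact hm0 (hs m h))
    refine ⟨q.coeff m / s.coeff m, fun i hi => ?_, fun i hi => ?_⟩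
    · rw [hp i (by omega), hr i (by omega), mul_zero, sub_zero]
    · obtain rfl | him := eq_or_ne i m
      · rw [div_mul_cancel₀ _ hm0, sub_self]
      · rw [hq i (by omega), hs i (by omega), mul_zero, sub_zero]

theorem pointPlace_zero : pointPlace E 0 = none := rfl

theorem exists_pointPlace_eq_some {P : E.toAffine.Point} (hP : P ≠ 0) :
    ∃ v, pointPlace E P = some v ∧ v.asIdeal = pointIdeal E P := by
  cases P with
  | zero => exact absurd rfl hP
  | some x y h => exact ⟨_, rfl, rfl⟩

variable [E.IsElliptic]

/-- The residue field at a rational point is the base field. -/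
theorem exists_residue (P : E.toAffine.Point) {f : FunField E}
    (hf : placeValuation E (pointPlace E P) f ≤ 1) :
    ∃ c : F, placeValuation E (pointPlace E P) (f - algebraMap F (FunField E) c) < 1 := by
  cases P with
  | zero =>
    obtain ⟨a, b, hb, rfl⟩ := IsFractionRing.div_surjective (A := CoordRing E) f
    change infinityValuation E _ ≤ 1 at hf
    change ∃ c : F, infinityValuation E _ < 1
    have hb0 : b ≠ 0 := nonZeroDivisors.ne_zero hb
    have hv0 : (0 : ℤᵐ⁰) < infinityValuation E (algebraMap _ _ b) := by
      rw [infinityValuation_algebraMap E hb0]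
      exact WithZero.exp_pos
    have hb1 : algebraMap (CoordRing E) (FunField E) b ≠ 0 := by
      simpa using hb0
    have hab : (Algebra.norm F[X] a).degree ≤ (Algebra.norm F[X] b).degree := by
      by_cases ha : a = 0
      · have : Algebra.norm F[X] a = 0 := by rw [ha]; exact Algebra.norm_zero
        rw [this]; simp
      rw [map_div₀, div_le_one₀ hv0, infinityValuation_algebraMap E ha,
        infinityValuation_algebraMap E hb0, WithZero.exp_le_exp] at hf
      rw [degree_eq_natDegree (norm_ne_zero E ha), degree_eq_natDegree (norm_ne_zero E hb0)]
      exact_mod_cast hf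
    obtain ⟨c, hc⟩ := exists_degree_norm_sub_lt E hb0 hab
    refine ⟨c, ?_⟩
    rw [IsScalarTower.algebraMap_apply F (CoordRing E) (FunField E), div_sub' hb1, map_div₀,
      div_lt_one₀ hv0, mul_comm, ← map_mul, ← map_sub]
    by_cases h0 : a - algebraMap F (CoordRing E) c * b = 0
    · rw [h0, map_zero, map_zero]; exact hv0
    rw [infinityValuation_algebraMap E h0, infinityValuation_algebraMap E hb0, WithZero.exp_lt_exp]
    rw [degree_eq_natDegree (norm_ne_zero E h0), degree_eq_natDegree (norm_ne_zero E hb0)] at hc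
    exact_mod_cast hc
  | some x y h =>
    set v : IsDedekindDomain.HeightOneSpectrum (CoordRing E) :=
      ⟨XYIdeal E.toAffine x (C y), XYIdeal_isPrime E h, XYIdeal_ne_bot E x y⟩
    change v.valuation (FunField E) f ≤ 1 at hf
    change ∃ c : F, v.valuation (FunField E) _ < 1
    -- Approximate `f` by a regular function `r` to first order at the point, then reduce `r` modulo
    -- the maximal ideal.
    obtain ⟨r, hr⟩ := v.exists_valuation_sub_lt_of_integer hf 1
    obtain ⟨c, hc⟩ := exists_sub_mem_pointIdeal E (Point.some x y h) r
    refine ⟨c, ?_⟩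
    have h1 : v.valuation (FunField E) (algebraMap (CoordRing E) (FunField E)
        (r - algebraMap F (CoordRing E) c)) < 1 := (v.valuation_lt_one_iff_mem _).mpr hc
    rw [Valuation.map_sub_swap, Units.val_one] at hr
    have h2 := Valuation.map_add_lt _ hr h1
    rw [IsScalarTower.algebraMap_apply F (CoordRing E) (FunField E)]
    convert h2 using 2
    rw [map_sub]; ring

-- Turns agreement of values into a zero of the difference. Regularity is needed because `evalAt` is
-- `0` by default at a pole.
variable {E} in
theorem evalAt_eq_evalAt_iff {f g : FunField E} {P : E.toAffine.Point}
    (hf : placeValuation E (pointPlace E P) f ≤ 1)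
    (hg : placeValuation E (pointPlace E P) g ≤ 1) :
    evalAt E f P = evalAt E g P ↔ placeValuation E (pointPlace E P) (f - g) < 1 := by
  obtain ⟨c, hc⟩ := exists_residue E P hf
  rw [evalAt_eq E hc]
  constructor
  · intro h
    obtain ⟨d, hd⟩ := exists_residue E P hg
    rw [evalAt_eq E hd] at h
    subst h
    simpa using Valuation.map_sub_lt _ hc hd
  · intro h
    symm
    apply evalAt_eq
    simpa using Valuation.map_sub_lt _ hc h

end Valuations

/-- Cancelling `I` gives `J = (r) * K`. Used to show that a function without a pole at `Q` would
force `Q` among the prescribed zeros. -/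
theorem le_of_mul_eq_span_mul {R : Type*} [CommRing R] [IsDedekindDomain R] {I J K : Ideal R}
    {r g : R} (hI : I ≠ ⊥) (hg : I * K = Ideal.span {g}) (h : I * J = Ideal.span {r * g}) :
    J ≤ K := by
  rw [← Ideal.span_singleton_mul_span_singleton, ← hg, mul_left_comm] at h
  rw [mul_left_cancel₀ hI h]
  exact Ideal.mul_le_right

/-! ### The spaces `L(Q + m O)` in terms of the coordinate ring. -/

section PointDivisors

variable {F : Type*} [Field F] {E : WeierstrassCurve F}

variable (E) in
/-- The divisor `Q + m O`. -/
noncomputable abbrev pointDivisor (Q : E.toAffine.Point) (m : ℤ) : Divisor E :=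
  Finsupp.single (pointPlace E Q) 1 + Finsupp.single (pointPlace E 0) m

/-- The two summands share a place exactly when `Q = O`; `affineDegree` merges both cases. -/
theorem pointDivisor_none (Q : E.toAffine.Point) (m : ℤ) :
    pointDivisor E Q m none = m + 1 - affineDegree E Q := by
  rw [pointDivisor, Finsupp.add_apply, pointPlace_zero, Finsupp.single_eq_same]
  cases Q with
  | zero =>
    rw [show pointPlace E Point.zero = none from rfl, Finsupp.single_eq_same]
    simp [affineDegree]; ring
  | some x y h =>
    simp [pointPlace, affineDegree]

theorem pointDivisor_some_of_ne {Q : E.toAffine.Point} {m : ℤ}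
    {v : IsDedekindDomain.HeightOneSpectrum (CoordRing E)} (hv : v.asIdeal ≠ pointIdeal E Q) :
    pointDivisor E Q m (some v) = 0 := by
  rw [pointDivisor, Finsupp.add_apply, pointPlace_zero, Finsupp.single_eq_of_ne, Finsupp.single_eq_of_ne,
    add_zero]
  · simp
  · intro h
    cases Q with
    | zero => cases h
    | some x y h' => exact hv (congrArg _ (Option.some.inj h))

theorem pointDivisor_some_of_eq {Q : E.toAffine.Point} {m : ℤ}
    {v : IsDedekindDomain.HeightOneSpectrum (CoordRing E)} (hv : v.asIdeal = pointIdeal E Q) :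
    pointDivisor E Q m (some v) = 1 := by
  have hQ : Q ≠ 0 := by
    rintro rfl
    exact v.isPrime.ne_top hv
  obtain ⟨w, hw, hw'⟩ := exists_pointPlace_eq_some E hQ
  obtain rfl : v = w := IsDedekindDomain.HeightOneSpectrum.ext (hv.trans hw'.symm)
  rw [pointDivisor, Finsupp.add_apply, pointPlace_zero, hw, Finsupp.single_eq_same,
    Finsupp.single_eq_of_ne (by simp), add_zero]

theorem single_eq_pointDivisor (m : ℤ) :
    Finsupp.single (pointPlace E 0) m = pointDivisor E 0 (m - 1) := by
  rw [pointDivisor, ← Finsupp.single_add, add_sub_cancel]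

variable [E.IsElliptic]

theorem mem_riemannRochSpace_iff {D : Divisor E} {f : FunField E} :
    f ∈ riemannRochSpace E D ↔ ∀ v, placeValuation E v f ≤ WithZero.exp (D v) := Iff.rfl

theorem single_le_riemannRochSpace (Q : E.toAffine.Point) (m : ℤ) :
    riemannRochSpace E (Finsupp.single (pointPlace E 0) m) ≤
      riemannRochSpace E (pointDivisor E Q m) := by
  intro f hf v
  refine (hf v).trans (WithZero.exp_le_exp.mpr ?_)
  rw [pointDivisor, Finsupp.add_apply]
  have : (0 : Divisor E) ≤ Finsupp.single (pointPlace E Q) 1 := Finsupp.single_nonneg.mpr zero_le_one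
  exact le_add_of_nonneg_left (this v)

/-- Membership in `L(Q + m O)`, in terms of the coordinate ring. -/
theorem mem_riemannRochSpace_pointDivisor_iff {Q : E.toAffine.Point} {m : ℤ} {f : FunField E} :
    f ∈ riemannRochSpace E (pointDivisor E Q m) ↔
      infinityValuation E f ≤ WithZero.exp (m + 1 - affineDegree E Q) ∧
      ∀ z ∈ pointIdeal E Q, ∃ r : CoordRing E,
        algebraMap _ (FunField E) r = f * algebraMap _ _ z := by
  rw [mem_riemannRochSpace_iff, ← pointDivisor_none]
  constructor
  · intro h
    refine ⟨h none, fun z hz => ?_⟩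
    apply IsDedekindDomain.HeightOneSpectrum.mem_integers_of_valuation_le_one
    intro v
    have hv : v.valuation (FunField E) f ≤ _ := h (some v)
    rw [map_mul]
    by_cases hvQ : v.asIdeal = pointIdeal E Q
    · rw [pointDivisor_some_of_eq hvQ] at hv
      have hz' : v.valuation (FunField E) (algebraMap _ _ z) ≤ WithZero.exp (-1) := by
        have := (v.intValuation_le_pow_iff_mem z 1).mpr (by rwa [pow_one, hvQ])
        rw [v.valuation_of_algebraMap]
        simpa using this
      refine (mul_le_mul' hv hz').trans_eq ?_
      rw [← WithZero.exp_add]; rfl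
    · rw [pointDivisor_some_of_ne hvQ] at hv
      exact mul_le_one' hv (v.valuation_le_one z)
  · rintro ⟨h, h'⟩ (_ | v)
    · exact h
    change v.valuation (FunField E) f ≤ _
    by_cases hvQ : v.asIdeal = pointIdeal E Q
    · rw [pointDivisor_some_of_eq hvQ]
      -- At `Q`, multiplying by a uniformizer bounds the pole order by `1`; elsewhere one multiplies
      -- by some `z` that is a unit at `v`.
      obtain ⟨z, hz⟩ := v.intValuation_exists_uniformizer
      obtain ⟨r, hr⟩ := h' z (by
        rw [← hvQ, ← v.intValuation_lt_one_iff_mem, hz]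
        exact WithZero.exp_lt_exp.mpr (by norm_num : (-1 : ℤ) < 0))
      have h1 : v.valuation (FunField E) (algebraMap _ _ r) ≤ 1 := v.valuation_le_one r
      rw [hr, map_mul, v.valuation_of_algebraMap, hz] at h1
      have h2 := mul_le_mul_left h1 (WithZero.exp 1)
      rw [mul_assoc, ← WithZero.exp_add] at h2
      simpa using h2
    · rw [pointDivisor_some_of_ne hvQ]
      obtain ⟨z, hz, hzv⟩ : ∃ z ∈ pointIdeal E Q, z ∉ v.asIdeal := by
        by_contra! hle
        by_cases hQ : Q = 0
        · subst hQ
          exact v.isPrime.ne_top (top_le_iff.mp hle)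
        · exact hvQ ((pointIdeal_isMaximal E hQ).eq_of_le v.isPrime.ne_top hle).symm
      obtain ⟨r, hr⟩ := h' z hz
      have h1 : v.valuation (FunField E) (algebraMap _ _ r) ≤ 1 := v.valuation_le_one r
      rwa [hr, map_mul, (v.valuation_eq_one_iff_notMem).mpr hzv, mul_one] at h1

/-- As `P ≠ Q`, some `z` in the ideal of `Q` is a unit at `P`, so `f` and `f * z` vanish at `P`
together. -/
theorem valuation_lt_one_iff_forall_mem [DecidableEq F] {Q P : E.toAffine.Point} (hP : P ≠ 0)
    (hPQ : P ≠ Q) {f : FunField E} (hf : ∀ z ∈ pointIdeal E Q, ∃ r : CoordRing E,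
      algebraMap _ (FunField E) r = f * algebraMap _ _ z) :
    placeValuation E (pointPlace E P) f < 1 ↔ ∀ z ∈ pointIdeal E Q, ∀ r : CoordRing E,
      algebraMap _ (FunField E) r = f * algebraMap _ _ z → r ∈ pointIdeal E P := by
  obtain ⟨v, hv, hv'⟩ := exists_pointPlace_eq_some E hP
  rw [hv, ← hv']
  change v.valuation (FunField E) f < 1 ↔ _
  constructor
  · intro h z hz r hr
    refine (v.valuation_lt_one_iff_mem (K := FunField E) r).mp ?_
    change v.valuation (FunField E) (algebraMap _ _ r) < 1
    rw [hr, map_mul]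
    exact mul_lt_one_of_lt_of_le h (v.valuation_le_one z)
  · intro h
    obtain ⟨z, hz, hzv⟩ : ∃ z ∈ pointIdeal E Q, z ∉ v.asIdeal := by
      by_contra! hle
      exact hPQ (eq_of_pointIdeal_le E hP (hv' ▸ hle)).symm
    obtain ⟨r, hr⟩ := hf z hz
    have h1 : v.valuation (FunField E) (algebraMap _ _ r) < 1 :=
      (v.valuation_lt_one_iff_mem r).mpr (h z hz r hr)
    rwa [hr, map_mul, (v.valuation_eq_one_iff_notMem).mpr hzv, mul_one] at h1

theorem mem_riemannRochSpace_single_iff {m : ℤ} {f : FunField E} :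
    f ∈ riemannRochSpace E (Finsupp.single (pointPlace E 0) m) ↔
      infinityValuation E f ≤ WithZero.exp m ∧
      ∃ r : CoordRing E, algebraMap _ (FunField E) r = f := by
  rw [single_eq_pointDivisor, mem_riemannRochSpace_pointDivisor_iff, affineDegree_zero]
  refine and_congr (by simp) ⟨fun h => ?_, ?_⟩
  · simpa using h 1 Submodule.mem_top
  · rintro ⟨r, rfl⟩ z -
    exact ⟨r * z, map_mul _ _ _⟩

theorem placeValuation_le_one_of_mem [DecidableEq F] {Q P : E.toAffine.Point} (hP : P ≠ 0)
    (hPQ : P ≠ Q) {m : ℤ} {f : FunField E} (hf : f ∈ riemannRochSpace E (pointDivisor E Q m)) :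
    placeValuation E (pointPlace E P) f ≤ 1 := by
  obtain ⟨v, hv, hv'⟩ := exists_pointPlace_eq_some E hP
  have h := hf (some v)
  rwa [pointDivisor_some_of_ne (hv' ▸ fun h => hPQ (pointIdeal_injective E h)), WithZero.exp_zero,
    ← hv] at h

/-! ### Counting zeros and constructing functions. -/

theorem natDegree_norm_of_span_eq {Q : E.toAffine.Point} {g : CoordRing E} (hg0 : g ≠ 0)
    (hg : pointIdeal E (-Q) * pointIdeal E Q = Ideal.span {g}) :
    (Algebra.norm F[X] g).natDegree = 2 * affineDegree E Q := by
  refine (hg ▸ hasNormDegree_span hg0).unique ?_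
  rw [two_mul]
  nth_rewrite 1 [← affineDegree_neg]
  exact (hasNormDegree_pointIdeal _).mul (hasNormDegree_pointIdeal _)

/-- Zeros of a function in `L(Q + m O)` at distinct rational points `P i`: there are at most
`m + 1` of them, and if there are `m + 1` then they sum to `Q`. -/
theorem card_zeros_le [DecidableEq F] {ι : Type*} {Q : E.toAffine.Point} {P : ι → E.toAffine.Point}
    (hP : Function.Injective P) (hPO : ∀ i, P i ≠ 0) (hPQ : ∀ i, P i ≠ Q) {k : ℕ}
    {h : FunField E} (h0 : h ≠ 0) (hmem : h ∈ riemannRochSpace E (pointDivisor E Q ((k : ℤ) - 1)))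
    (S : Finset ι) (hS : ∀ i ∈ S, placeValuation E (pointPlace E (P i)) h < 1) :
    S.card ≤ k ∧ (S.card = k → ∑ i ∈ S, P i = Q) := by
  classical
  obtain ⟨hinf, hint⟩ := mem_riemannRochSpace_pointDivisor_iff.mp hmem
  obtain ⟨g, hg0, hg⟩ := exists_pointIdeal_neg_mul E Q
  -- `h * g` vanishes at the chosen `P i` and also at `-Q`, the extra zero of `g`.
  set T : Multiset E.toAffine.Point := -Q ::ₘ S.val.map P with hT
  have hTprod : (T.map (pointIdeal E)).prod = pointIdeal E (-Q) * ∏ i ∈ S, pointIdeal E (P i) := by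
    rw [hT, Multiset.map_cons, Multiset.prod_cons, Multiset.map_map]; rfl
  have hmul : ∀ w ∈ pointIdeal E (-Q) * pointIdeal E Q, ∃ r ∈ (T.map (pointIdeal E)).prod,
      algebraMap (CoordRing E) (FunField E) r = h * algebraMap _ _ w := by
    intro w hw
    induction hw using Submodule.mul_induction_on' with
    | mem_mul_mem u hu z hz =>
      obtain ⟨r, hr⟩ := hint z hz
      refine ⟨u * r, ?_, by rw [map_mul, map_mul, hr]; ring⟩
      rw [hTprod]
      refine Ideal.mul_mem_mul hu ?_
      -- The points are distinct, so vanishing at each of them is membership in the product of their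
      -- ideals.
      have hinf := IsDedekindDomain.inf_pow_eq_prod_of_prime S (fun i => pointIdeal E (P i))
        (fun _ => 1) (fun i _ => Ideal.prime_of_isPrime (pointIdeal_ne_bot E _)
          (pointIdeal_isMaximal E (hPO i)).isPrime)
        (fun i _ j _ hij h => hij (hP (pointIdeal_injective E h)))
      simp only [pow_one] at hinf
      rw [← hinf, Submodule.mem_finsetInf]
      exact fun i hi => (valuation_lt_one_iff_forall_mem (hPO i) (hPQ i) hint).mp (hS i hi) z hz r hr
    | add x _ y _ hx hy =>
      obtain ⟨r, hrm, hr⟩ := hx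
      obtain ⟨s, hsm, hs⟩ := hy
      exact ⟨r + s, add_mem hrm hsm, by rw [map_add, map_add, hr, hs]; ring⟩
  obtain ⟨a, haT, ha⟩ := hmul g (hg ▸ Ideal.mem_span_singleton_self g)
  have hg1 : algebraMap (CoordRing E) (FunField E) g ≠ 0 := by simpa using hg0
  have ha0 : a ≠ 0 := by
    rintro rfl
    rw [map_zero] at ha
    exact mul_ne_zero h0 hg1 ha.symm
  -- With `d = affineDegree E Q`, the pole order of `a = h * g` at `O` is at most `(k - d) + 2d`.
  have hdeg : (Algebra.norm F[X] a).natDegree ≤ k + affineDegree E Q := by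
    have h1 := mul_le_mul_left hinf (WithZero.exp ((Algebra.norm F[X] g).natDegree : ℤ))
    rw [← infinityValuation_algebraMap E hg0, ← map_mul, ← ha, infinityValuation_algebraMap E ha0,
      infinityValuation_algebraMap E hg0, ← WithZero.exp_add, WithZero.exp_le_exp,
      natDegree_norm_of_span_eq hg0 hg] at h1
    push_cast at h1
    omega
  have hTdeg : (T.map (affineDegree E)).sum = S.card + affineDegree E Q := by
    rw [hT, Multiset.map_cons, Multiset.sum_cons, Multiset.map_map, affineDegree_neg, add_comm]
    congr 1
    change ∑ i ∈ S, affineDegree E (P i) = _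
    rw [Finset.sum_congr rfl fun i _ => affineDegree_of_ne_zero E (hPO i), Finset.card_eq_sum_ones]
  obtain ⟨hle, heq⟩ := (hasNormDegree_multiset_prod T).le_natDegree_norm ha0 haT
  rw [hTdeg] at hle heq
  refine ⟨by omega, fun hk => ?_⟩
  -- Equality of degrees makes `a` generate the product ideal, so the points of `T` sum to zero.
  have hsum := (multiset_sum_eq_zero_iff E T).mpr ⟨a, heq (by omega)⟩
  rw [hT, Multiset.sum_cons] at hsum
  exact (neg_add_eq_zero.mp hsum).symm

/-- A function with prescribed zeros in `L(Q + m O)`, having a full pole at `Q`. -/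
theorem exists_function_of_sum_eq [DecidableEq F] {ι : Type*} {Q B : E.toAffine.Point}
    {P : ι → E.toAffine.Point} (hPO : ∀ i, P i ≠ 0) (hPQ : ∀ i, P i ≠ Q) (hBQ : B ≠ Q)
    (T : Finset ι) (hsum : B + ∑ i ∈ T, P i = Q) :
    ∃ h ∈ riemannRochSpace E (pointDivisor E Q T.card),
      h ∉ riemannRochSpace E (Finsupp.single (pointPlace E 0) (T.card : ℤ)) ∧
      (∀ i ∈ T, placeValuation E (pointPlace E (P i)) h < 1) ∧
      (B ≠ 0 → placeValuation E (pointPlace E B) h < 1) := by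
  obtain ⟨g, hg0, hg⟩ := exists_pointIdeal_neg_mul E Q
  set J : Ideal (CoordRing E) := pointIdeal E B * ∏ i ∈ T, pointIdeal E (P i) with hJ
  set U : Multiset E.toAffine.Point := -Q ::ₘ B ::ₘ T.val.map P with hU
  have hUprod : (U.map (pointIdeal E)).prod = pointIdeal E (-Q) * J := by
    rw [hU, Multiset.map_cons, Multiset.prod_cons, Multiset.map_cons, Multiset.prod_cons,
      Multiset.map_map]; rfl
  have hUdeg : (U.map (affineDegree E)).sum = affineDegree E Q + (affineDegree E B + T.card) := by
    rw [hU, Multiset.map_cons, Multiset.sum_cons, Multiset.map_cons, Multiset.sum_cons,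
      Multiset.map_map, affineDegree_neg]
    congr 2
    change ∑ i ∈ T, affineDegree E (P i) = _
    rw [Finset.sum_congr rfl fun i _ => affineDegree_of_ne_zero E (hPO i), Finset.card_eq_sum_ones]
  obtain ⟨a, ha⟩ := (multiset_sum_eq_zero_iff E U).mp (by
    rw [hU, Multiset.sum_cons, Multiset.sum_cons, neg_add_eq_zero]; exact hsum.symm)
  rw [Ideal.submodule_span_eq] at ha
  have ha0 : a ≠ 0 := by
    rintro rfl
    exact multiset_prod_pointIdeal_ne_bot E U (ha.trans (Ideal.span_singleton_eq_bot.mpr rfl))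
  have hadeg := (ha ▸ hasNormDegree_span ha0).unique (hasNormDegree_multiset_prod U)
  rw [hUprod] at ha
  have hg1 : algebraMap (CoordRing E) (FunField E) g ≠ 0 := by simpa using hg0
  set h : FunField E := algebraMap _ _ a / algebraMap _ _ g with hh
  have hhg : h * algebraMap _ _ g = algebraMap _ _ a := div_mul_cancel₀ _ hg1
  have hinf : infinityValuation E h =
      WithZero.exp ((T.card : ℤ) + affineDegree E B - affineDegree E Q) := by
    rw [hh, map_div₀, infinityValuation_algebraMap E ha0, infinityValuation_algebraMap E hg0,
      ← WithZero.exp_sub, hadeg, hUdeg, natDegree_norm_of_span_eq hg0 hg]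
    congr 1
    push_cast
    ring
  have hint : ∀ z ∈ pointIdeal E Q, ∃ r ∈ J,
      algebraMap (CoordRing E) (FunField E) r = h * algebraMap _ _ z := by
    intro z hz
    -- The factor `I(-Q)` in `(a)` combines with `z ∈ I(Q)` to give `(g)`, which the denominator of
    -- `h` cancels.
    have h1 : a * z ∈ Ideal.span {g} * J := by
      rw [← hg, mul_right_comm, ha]
      exact Ideal.mul_mem_mul (Ideal.mem_span_singleton_self a) hz
    obtain ⟨r, hr, hr'⟩ := Ideal.mem_span_singleton_mul.mp h1
    refine ⟨r, hr, ?_⟩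
    apply mul_left_cancel₀ hg1
    rw [← map_mul, hr', map_mul, ← hhg]
    ring
  have hint' : ∀ z ∈ pointIdeal E Q, ∃ r : CoordRing E,
      algebraMap (CoordRing E) (FunField E) r = h * algebraMap _ _ z :=
    fun z hz => (hint z hz).imp fun r hr => hr.2
  have hzero : ∀ A : E.toAffine.Point, A ≠ 0 → A ≠ Q → J ≤ pointIdeal E A →
      placeValuation E (pointPlace E A) h < 1 := by
    intro A hA hAQ hJA
    refine (valuation_lt_one_iff_forall_mem hA hAQ hint').mpr fun z hz r hr => ?_
    obtain ⟨s, hs, hs'⟩ := hint z hz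
    rw [IsFractionRing.injective (CoordRing E) (FunField E) (hr.trans hs'.symm)]
    exact hJA hs
  have hBdeg : affineDegree E B ≤ 1 := by
    cases B <;> simp [affineDegree]
  refine ⟨h, mem_riemannRochSpace_pointDivisor_iff.mpr ⟨?_, hint'⟩, fun hmem => ?_, fun i hi => ?_,
    fun hB => ?_⟩
  · rw [hinf, WithZero.exp_le_exp]
    omega
  · obtain ⟨hle, r, hr⟩ := mem_riemannRochSpace_single_iff.mp hmem
    -- If `Q = O`, then `B` is affine and the pole order at `O` is exactly `T.card + 1`. If `Q` is
    -- affine, regularity of `h` would put `Q` among `B` and the `P i`.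
    by_cases hQ : Q = 0
    · rw [hinf, WithZero.exp_le_exp, affineDegree_of_ne_zero E (hQ ▸ hBQ), hQ,
        affineDegree_zero] at hle
      omega
    · have hrg : a = r * g := by
        apply IsFractionRing.injective (CoordRing E) (FunField E)
        rw [map_mul, hr, hhg]
      have hJQ : J ≤ pointIdeal E Q := by
        rw [hrg] at ha
        exact le_of_mul_eq_span_mul (pointIdeal_ne_bot E (-Q)) hg ha
      have hQp := (pointIdeal_isMaximal E hQ).isPrime
      rw [hJ, hQp.mul_le, hQp.prod_le] at hJQ
      obtain hle | ⟨i, -, hle⟩ := hJQ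
      · exact hBQ (eq_of_pointIdeal_le E hQ hle)
      · exact hPQ i (eq_of_pointIdeal_le E hQ hle)
  · exact hzero _ (hPO i) (hPQ i) (Ideal.mul_le_right.trans
      (Ideal.prod_le_inf.trans (Finset.inf_le hi)))
  · exact hzero _ hB hBQ Ideal.mul_le_left

/-- `L(m O)` has codimension at most one in `L(Q + m O)`. -/
theorem exists_sub_smul_mem [DecidableEq F] {Q : E.toAffine.Point} {m : ℤ} {f h : FunField E}
    (hf : f ∈ riemannRochSpace E (pointDivisor E Q m))
    (hf' : f ∉ riemannRochSpace E (Finsupp.single (pointPlace E 0) m))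
    (hh : h ∈ riemannRochSpace E (pointDivisor E Q m))
    (hh' : h ∉ riemannRochSpace E (Finsupp.single (pointPlace E 0) m)) :
    ∃ c : F, c ≠ 0 ∧ f - c • h ∈ riemannRochSpace E (Finsupp.single (pointPlace E 0) m) := by
  -- The coefficient of `m O` at `Q`: `m` if `Q = O`, otherwise `0`. The two spaces differ only by
  -- pole order `e + 1` at `Q`.
  set e : ℤ := Finsupp.single (pointPlace E 0) m (pointPlace E Q) with he
  have hQ : pointDivisor E Q m (pointPlace E Q) = e + 1 := by
    rw [pointDivisor, Finsupp.add_apply, Finsupp.single_eq_same, add_comm]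
  have key : ∀ u ∈ riemannRochSpace E (pointDivisor E Q m),
      placeValuation E (pointPlace E Q) u ≤ WithZero.exp e →
      u ∈ riemannRochSpace E (Finsupp.single (pointPlace E 0) m) := by
    intro u hu hle v
    by_cases hv : v = pointPlace E Q
    · rw [hv]; exact hle
    · have := hu v
      rwa [pointDivisor, Finsupp.add_apply, Finsupp.single_eq_of_ne hv, zero_add] at this
  have hlt : WithZero.exp e < placeValuation E (pointPlace E Q) h := by
    by_contra! hle
    exact hh' (key h hh hle)
  have hh0 : h ≠ 0 := by
    rintro rfl
    exact hh' (zero_mem _)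
  have hvh : placeValuation E (pointPlace E Q) h = WithZero.exp (e + 1) := by
    refine le_antisymm (hQ ▸ hh _) ?_
    have h0 : placeValuation E (pointPlace E Q) h ≠ 0 := (Valuation.ne_zero_iff _).mpr hh0
    rw [← WithZero.exp_log h0] at hlt ⊢
    rw [WithZero.exp_lt_exp] at hlt
    exact WithZero.exp_le_exp.mpr hlt
  have hpos : (0 : ℤᵐ⁰) < placeValuation E (pointPlace E Q) h := by
    rw [hvh]; exact WithZero.exp_pos
  -- `h` has pole order exactly `e + 1` at `Q`, so `c` is the ratio of leading coefficients and `f -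
  -- c • h` loses that pole.
  obtain ⟨c, hc⟩ := exists_residue E Q (f := f / h) (by
    rw [map_div₀, div_le_one₀ hpos, hvh]
    exact hQ ▸ hf _)
  have hmem : f - c • h ∈ riemannRochSpace E (Finsupp.single (pointPlace E 0) m) := by
    refine key _ (sub_mem hf (Submodule.smul_mem _ c hh)) ?_
    rw [div_sub' hh0, map_div₀, div_lt_one₀ hpos, mul_comm, ← Algebra.smul_def, hvh] at hc
    generalize f - c • h = u at hc ⊢
    by_cases hu : placeValuation E (pointPlace E Q) u = 0
    · rw [hu]; exact zero_le
    rw [← WithZero.exp_log hu] at hc ⊢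
    rw [WithZero.exp_lt_exp] at hc
    exact WithZero.exp_le_exp.mpr (by omega)
  refine ⟨c, ?_, hmem⟩
  rintro rfl
  rw [zero_smul, sub_zero] at hmem
  exact hf' hmem

end PointDivisors

/-! ### Agreement with codewords and Hamming distance. -/

section Distance

theorem hammingDist_eq_sub_card {α : Type*} [DecidableEq α] {n : ℕ} (u w : Fin n → α) :
    hammingDist u w = n - (Finset.univ.filter fun i => u i = w i).card := by
  have h := Finset.card_filter_add_card_filter_not (s := (Finset.univ : Finset (Fin n)))
    (fun i => u i = w i)
  rw [Finset.card_univ, Fintype.card_fin] at h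
  exact Nat.eq_sub_of_add_eq' h

theorem distToCode_le {α : Type*} [DecidableEq α] {n : ℕ} {R c : Fin n → α}
    {C : Set (Fin n → α)} (hc : c ∈ C) : distToCode R C ≤ hammingDist R c :=
  Nat.sInf_le ⟨c, hc, rfl⟩

theorem exists_hammingDist_eq_distToCode {α : Type*} [DecidableEq α] {n : ℕ} (R : Fin n → α)
    {C : Set (Fin n → α)} (hC : C.Nonempty) : ∃ c ∈ C, hammingDist R c = distToCode R C := by
  obtain ⟨c, hc⟩ := hC
  obtain ⟨c', hc', h⟩ := Nat.sInf_mem (s := {d | ∃ c ∈ C, d = hammingDist R c}) ⟨_, c, hc, rfl⟩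
  exact ⟨c', hc', h.symm⟩

/-- Among `k` distinct elements of a group one can pick `k - 1` with sum different from a given
element, provided `2 ≤ k`. -/
theorem exists_subset_sum_ne {G ι : Type*} [AddCommGroup G] [DecidableEq ι] {P : ι → G}
    (hP : Function.Injective P) {S : Finset ι} {k : ℕ} (hS : S.card = k + 1) (hk : 1 ≤ k) (A : G) :
    ∃ T : Finset ι, T.card = k ∧ ∑ i ∈ T, P i ≠ A := by
  obtain ⟨i, hi, j, hj, hij⟩ := Finset.one_lt_card.mp (show 1 < S.card by omega)
  -- Omitting `i` or `j` gives sums differing by `P i - P j ≠ 0`, so at most one of them equals `A`.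
  by_cases h : ∑ l ∈ S.erase i, P l = A
  · refine ⟨S.erase j, by rw [Finset.card_erase_of_mem hj, hS]; rfl, fun h' => hij (hP ?_)⟩
    have h1 := Finset.add_sum_erase S P hi
    have h2 := Finset.add_sum_erase S P hj
    rw [h] at h1
    rw [h', ← h1] at h2
    exact (add_right_cancel h2).symm
  · exact ⟨S.erase i, by rw [Finset.card_erase_of_mem hi, hS]; rfl, h⟩

variable {F : Type*} [Field F] [DecidableEq F] {E : WeierstrassCurve F} [E.IsElliptic]

/-- Agreement of a word of `L(Q + m O)` with the code of `L(m O)`: on at most `m + 1` positions,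
and if on `m + 1` then the corresponding points sum to `Q`. -/
theorem card_agree_le {n k : ℕ} {Q : E.toAffine.Point} {P : Fin n → E.toAffine.Point}
    (hP : Function.Injective P) (hPO : ∀ i, P i ≠ 0) (hPQ : ∀ i, P i ≠ Q) {f' f : FunField E}
    (hf' : f' ∈ riemannRochSpace E (pointDivisor E Q ((k : ℤ) - 1)))
    (hf'_not : f' ∉ riemannRochSpace E (Finsupp.single (pointPlace E 0) ((k : ℤ) - 1)))
    (hf : f ∈ riemannRochSpace E (Finsupp.single (pointPlace E 0) ((k : ℤ) - 1))) :
    (Finset.univ.filter fun i => evalAt E f' (P i) = evalAt E f (P i)).card ≤ k ∧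
      ((Finset.univ.filter fun i => evalAt E f' (P i) = evalAt E f (P i)).card = k →
        ∑ i ∈ Finset.univ.filter fun i => evalAt E f' (P i) = evalAt E f (P i), P i = Q) := by
  have hfD := single_le_riemannRochSpace Q _ hf
  refine card_zeros_le hP hPO hPQ (h := f' - f) (fun h => hf'_not ?_) (sub_mem hf' hfD) _
    fun i hi => ?_
  · rwa [sub_eq_zero.mp h]
  · exact (evalAt_eq_evalAt_iff (placeValuation_le_one_of_mem (hPO i) (hPQ i) hf')
      (placeValuation_le_one_of_mem (hPO i) (hPQ i) hfD)).mp (Finset.mem_filter.mp hi).2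

/-- Interpolation: a word of `L(Q + m O)` agrees with some codeword of `L(m O)` at `m` given
points `P i`, and at a further point `B` if `B` and these `P i` sum to `Q`. -/
theorem exists_agree {n k : ℕ} {Q B : E.toAffine.Point}
    {P : Fin n → E.toAffine.Point} (hPO : ∀ i, P i ≠ 0) (hPQ : ∀ i, P i ≠ Q) {f' : FunField E}
    (hf' : f' ∈ riemannRochSpace E (pointDivisor E Q ((k : ℤ) - 1)))
    (hf'_not : f' ∉ riemannRochSpace E (Finsupp.single (pointPlace E 0) ((k : ℤ) - 1)))
    (hBQ : B ≠ Q) (T : Finset (Fin n)) (hT : T.card + 1 = k) (hsum : B + ∑ i ∈ T, P i = Q) :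
    ∃ f ∈ riemannRochSpace E (Finsupp.single (pointPlace E 0) ((k : ℤ) - 1)),
      (∀ i ∈ T, evalAt E f' (P i) = evalAt E f (P i)) ∧
      ∀ i, P i = B → evalAt E f' (P i) = evalAt E f (P i) := by
  obtain ⟨h, hh, hh', hhT, hhB⟩ := exists_function_of_sum_eq hPO hPQ hBQ T hsum
  have hTk : (T.card : ℤ) = (k : ℤ) - 1 := by omega
  rw [hTk] at hh hh'
  obtain ⟨c, -, hc⟩ := exists_sub_smul_mem hf' hf'_not hh hh'
  -- The difference between `f'` and the codeword function is `c • h`.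
  have key : ∀ i, placeValuation E (pointPlace E (P i)) h < 1 →
      evalAt E f' (P i) = evalAt E (f' - c • h) (P i) := by
    intro i hi
    refine (evalAt_eq_evalAt_iff (placeValuation_le_one_of_mem (hPO i) (hPQ i) hf')
      (placeValuation_le_one_of_mem (hPO i) (hPQ i)
        (single_le_riemannRochSpace Q _ hc))).mpr ?_
    rw [sub_sub_cancel, Algebra.smul_def, map_mul, mul_comm]
    exact mul_lt_one_of_lt_of_le hi (placeValuation_algebraMap_le_one E _ c)
  refine ⟨_, hc, fun i hi => key i (hhT i hi), fun i hi => key i ?_⟩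
  rw [hi]
  exact hhB (hi ▸ hPO i)

end Distance
end EllipticCode

/-! ### The main theorem. -/

open EllipticCode in
theorem mainTheorem3 {F : Type*} [Field F] [Finite F] [DecidableEq F]
    (E : WeierstrassCurve F) [E.IsElliptic]
    (n k : ℕ) (hk : 1 ≤ k) (hkn : k ≤ n)
    (Q : E.toAffine.Point) (P : Fin n → E.toAffine.Point)
    (hP : Function.Injective P) (hPO : ∀ i, P i ≠ 0) (hPQ : ∀ i, P i ≠ Q)
    (f' : EllipticCode.FunField E)
    (hf' : f' ∈ EllipticCode.riemannRochSpace E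
      (Finsupp.single (EllipticCode.pointPlace E Q) 1 +
        Finsupp.single (EllipticCode.pointPlace E 0) ((k : ℤ) - 1)))
    (hf'_not : f' ∉ EllipticCode.riemannRochSpace E
      (Finsupp.single (EllipticCode.pointPlace E 0) ((k : ℤ) - 1))) :
    (EllipticCode.distToCode (fun i => EllipticCode.evalAt E f' (P i))
        (EllipticCode.agCode E
          (Finsupp.single (EllipticCode.pointPlace E 0) ((k : ℤ) - 1)) P) = n - k + 1 ∨
      EllipticCode.distToCode (fun i => EllipticCode.evalAt E f' (P i))
        (EllipticCode.agCode E
          (Finsupp.single (EllipticCode.pointPlace E 0) ((k : ℤ) - 1)) P) = n - k) ∧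
    (EllipticCode.distToCode (fun i => EllipticCode.evalAt E f' (P i))
        (EllipticCode.agCode E
          (Finsupp.single (EllipticCode.pointPlace E 0) ((k : ℤ) - 1)) P) = n - k ↔
      ∃ S : Finset (Fin n), S.card = k ∧ ∑ i ∈ S, P i = Q) := by
  set R : Fin n → F := fun i => evalAt E f' (P i) with hR
  set C := agCode E (Finsupp.single (pointPlace E 0) ((k : ℤ) - 1)) P with hC
  have hC0 : C.Nonempty := ⟨_, 0, zero_mem _, rfl⟩
  obtain ⟨c, ⟨f, hf, rfl⟩, hd⟩ := exists_hammingDist_eq_distToCode R hC0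
  rw [hammingDist_eq_sub_card] at hd
  change n - (Finset.univ.filter fun i => evalAt E f' (P i) = evalAt E f (P i)).card = _ at hd
  obtain ⟨hle, heq⟩ := card_agree_le hP hPO hPQ hf' hf'_not hf
  have hlower : n - k ≤ distToCode R C := by omega
  have hupper : ∀ f ∈ riemannRochSpace E (Finsupp.single (pointPlace E 0) ((k : ℤ) - 1)),
      ∀ S : Finset (Fin n), (∀ i ∈ S, evalAt E f' (P i) = evalAt E f (P i)) →
      distToCode R C ≤ n - S.card := by
    intro f hf S hS
    refine (distToCode_le (show (fun i => evalAt E f (P i)) ∈ C from ⟨f, hf, rfl⟩)).trans ?_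
    rw [hammingDist_eq_sub_card]
    exact Nat.sub_le_sub_left (Finset.card_le_card fun i hi =>
      Finset.mem_filter.mpr ⟨Finset.mem_univ i, hS i hi⟩) n
  have hgen : distToCode R C ≤ n - k + 1 := by
    -- For `k = 1` the only choice `T = ∅` would force `B = Q`, but the bound is then the trivial
    -- `n`.
    obtain rfl | hk2 := hk.eq_or_lt
    · have := hupper 0 (zero_mem _) ∅ (by simp)
      simp at this
      omega
    obtain ⟨S, -, hS⟩ := Finset.exists_subset_card_eq
      (show k ≤ (Finset.univ : Finset (Fin n)).card by simpa using hkn)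
    -- A nonzero sum over `T` is what makes `B = Q - ∑ P i` different from `Q`.
    obtain ⟨T, hT, hTsum⟩ := exists_subset_sum_ne hP (S := S) (k := k - 1) (by omega) (by omega) 0
    obtain ⟨f, hf, hfT, -⟩ := exists_agree (B := Q - ∑ i ∈ T, P i) hPO hPQ hf' hf'_not
      (fun h => hTsum (sub_eq_self.mp h)) T (by omega) (sub_add_cancel _ _)
    have := hupper f hf T hfT
    omega
  -- At distance `n - k` the nearest codeword agrees in exactly `k` places, since the agreement is
  -- at most `k ≤ n`; this agreement set is the witness.
  refine ⟨by omega, fun h => ⟨_, ?_, heq ?_⟩, ?_⟩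
  · omega
  · omega
  · rintro ⟨S, hS, hsum⟩
    obtain ⟨i, hi⟩ := Finset.card_pos.mp (by omega : 0 < S.card)
    -- One of the `k` points plays the role of `B`, so agreement holds on all of `S`.
    obtain ⟨f, hf, hfT, hfB⟩ := exists_agree hPO hPQ hf' hf'_not (hPQ i) (S.erase i)
      (by rw [Finset.card_erase_of_mem hi]; omega) ((Finset.add_sum_erase S P hi).trans hsum)
    have := hupper f hf S fun j hj => by
      by_cases hji : j = i
      · exact hfB j (hji ▸ rfl)
      · exact hfT j (Finset.mem_erase.mpr ⟨hji, hj⟩)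
    omega
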